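/- Let $S$ (states) and $X$ (outcomes) be nonempty finite sets. Write $\Delta(S)$, $\Delta(X)$ for the sets of probability distributions on them, $\|\cdot\|$ for the Euclidean norm, $F$ for the set of acts $f:S\to\Delta(X)$, with statewise mixtures and with lotteries $p\in\Delta(X)$ identified with constant acts, and $fEg$ for the act equal to $f$ on $E\subseteq S$ and to $g$ off $E$. For $u:X\to\mathbb R$ let $u(p)=\sum_x p(x)u(x)$. An information set is a nonempty closed $I\subseteq\Delta(S)$ that is a finite union of convex sets; $\mathscr I$ is the collection of all of them. Let $\{\succsim_I\}_{I\in\mathscr I}$ be a family of binary relations on $F$, with asymmetric parts $\succ_I$ and symmetric parts $\sim_I$, and put $\succsim\,=\,\succsim_{\Delta(S)}$. Axioms: 1. (Standard Postulates) For every $I\in\mathscr I$: (i) $\succsim_I$ is complete and transitive; (ii) if $f\succ_I g\succ_I h$, there are $\alpha,\beta\in(0,1)$ with $\alpha f+(1-\alpha)h\succ_I g\succ_I\beta f+(1-\beta)h$; (iii) if $f(s)\succsim_I g(s)$ for all $s$, then $f\succsim_I g$; moreover, if $f(s)\succsim g(s)$ for all $s$ and $f(s)\succ g(s)$ for some $s$,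 then $f\succ g$; (iv) $f\succ_I g$ for some $f,g\in F$; (v) for all $f,g,h\in F$ and $\alpha\in(0,1]$, $f\succsim_I g$ iff $\alpha f+(1-\alpha)h\succsim_I\alpha g+(1-\alpha)h$; (vi) for $p,q\in\Delta(X)$, $p\succsim_I q$ iff $p\succsim q$. 2. (Compliance) $pEq\sim_{\{\pi\}}\pi(E)p+(1-\pi(E))q$ for all $p,q\in\Delta(X)$, $E\subseteq S$, $\pi\in\Delta(S)$. 3. (Responsiveness) For $I,I'\in\mathscr I$, if $\succsim_I=\succsim_{I'}$ then $I\cap I'\ne\emptyset$. 4. (Informational Betweenness) For $I_1,I_2,I'\in\mathscr I$ with $I_2\subseteq I'\subseteq I_1$, if $\succsim_{I_1}=\succsim_{I_2}$ then $\succsim_{I_1}=\succsim_{I'}$. 5. (Extremeness) For convex $I,I'\in\mathscr I$ with $I'\subseteq\mathrm{int}(I)$ (interior relative to $\Delta(S)$), if $\succsim_I\ne\succsim$ then $\succsim_{I'}\ne\succsim_I$. 6. (Weak Continuity) For distinct $\pi,\pi'\in\Delta(S)$ with $\succsim_{[\pi,\pi']}=\succsim_{\{\pi\}}$, where $[\pi,\pi']$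 is the line segment, there is $\epsilon>0$ with $\succsim_{\{\pi,\pi''\}}=\succsim_{\{\pi\}}$ for all $\pi''\in\Delta(S)$ with $\|\pi'-\pi''\|<\epsilon$. A distance function with respect to $\mu\in\Delta(S)$ is $d_\mu:\Delta(S)\to\mathbb R$ such that $d_\mu(\mu)<d_\mu(\pi)$ for all $\pi\neq\mu$, and for all $\pi\ne\pi'$ with $d_\mu(\pi)=d_\mu(\pi')$ there is $\alpha\in(0,1)$ with $d_\mu(\alpha\pi+(1-\alpha)\pi')<d_\mu(\pi)$. A tie-breaker for $d_\mu$ is a strict total order $\succ_{d_\mu}$ on $\Delta(S)$ such that $d_\mu(\pi)>d_\mu(\pi')$ implies $\pi\succ_{d_\mu}\pi'$. The function $d_\mu$ is locally nonsatiated if for all $\pi\ne\mu$ and $\epsilon>0$ there is $\pi'\in\Delta(S)$ with $\|\pi-\pi'\|<\epsilon$ and $d_\mu(\pi')<d_\mu(\pi)$. It is weakly continuous if whenever $d_\mu(\pi)<d_\mu(\pi')$ there is $\epsilon>0$ with $d_\mu(\pi)<d_\mu(\pi'')$ for all $\pi''\in\Delta(S)$ with $\|\pi'-\pi''\|<\epsilon$.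 The family has an Inertial Updating representation $(u,\mu,d_\mu,\succ_{d_\mu})$ if $u:X\to\mathbb R$ is nonconstant, $\mu\in\Delta(S)$ has full support, $d_\mu$ is a distance function with respect to $\mu$, $\succ_{d_\mu}$ is a tie-breaker for $d_\mu$, and for each $I\in\mathscr I$ the set $\arg\min d_\mu(I)$ has a (unique) $\succ_{d_\mu}$-minimal element $\mu_I$ such that for all $f,g\in F$, $f\succsim_I g$ iff $\sum_s\mu_I(s)u(f(s))\ge\sum_s\mu_I(s)u(g(s))$. Theorem. If $\{\succsim_I\}_{I\in\mathscr I}$ satisfies Axioms 1–6, then it has an Inertial Updating representation with a locally nonsatiated distance function. Conversely, if it has an Inertial Updating representation with a weakly continuous, locally nonsatiated distance function, then it satisfies Axioms 1–6. -/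

import Mathlib

namespace InertialUpdating

/-- `Δ(A)`: the probability distributions (lotteries) on a finite set `A`, as a subspace of
`A → ℝ` with its usual topology. -/
abbrev Prob (A : Type*) [Fintype A] : Type _ := ↥(stdSimplex ℝ A)

section Basic

variable {A : Type*} [Fintype A]

/-- The mixture `a p + (1 - a) q` of two distributions, for a weight `a ∈ [0, 1]`. -/
def mix (a : unitInterval) (p q : Prob A) : Prob A :=
  ⟨(a : ℝ) • (p : A → ℝ) + (1 - (a : ℝ)) • (q : A → ℝ),
    convex_stdSimplex ℝ A p.2 q.2 a.2.1 (sub_nonneg.2 a.2.2) (by ring)⟩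

/-- `π(E)`, the probability of the event `E`. -/
def probOf (π : Prob A) (E : Finset A) : unitInterval :=
  ⟨∑ s ∈ E, (π : A → ℝ) s, Finset.sum_nonneg fun s _ => π.2.1 s,
    (Finset.sum_le_univ_sum_of_nonneg fun s => π.2.1 s).trans_eq π.2.2⟩

/-- The Euclidean norm `‖π - π'‖`. -/
noncomputable def eucl (π π' : Prob A) : ℝ :=
  ‖WithLp.toLp 2 ((π : A → ℝ) - (π' : A → ℝ))‖

/-- Convexity of a set of distributions. -/
def IsConvex (C : Set (Prob A)) : Prop :=
  Convex ℝ ((fun π : Prob A => (π : A → ℝ)) '' C)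

/-- The line segment `[π, π']`. -/
def seg (π π' : Prob A) : Set (Prob A) :=
  {x | (x : A → ℝ) ∈ segment ℝ (π : A → ℝ) (π' : A → ℝ)}

theorem isConvex_singleton (π : Prob A) : IsConvex {π} := by
  simp [IsConvex]

theorem isConvex_seg (π π' : Prob A) : IsConvex (seg π π') := by
  have h : (fun x : Prob A => (x : A → ℝ)) '' seg π π'
      = segment ℝ (π : A → ℝ) (π' : A → ℝ) := by
    ext x
    constructor
    · rintro ⟨y, hy, rfl⟩
      exact hy
    · intro hx
      exact ⟨⟨x, (convex_stdSimplex ℝ A).segment_subset π.2 π'.2 hx⟩, hx, rfl⟩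
  unfold IsConvex
  rw [h]
  exact convex_segment _ _

theorem isConvex_univ : IsConvex (Set.univ : Set (Prob A)) := by
  have h : (fun x : Prob A => (x : A → ℝ)) '' Set.univ = stdSimplex ℝ A := by
    ext x
    exact ⟨fun ⟨y, _, hy⟩ => hy ▸ y.2, fun hx => ⟨⟨x, hx⟩, trivial, rfl⟩⟩
  unfold IsConvex
  rw [h]
  exact convex_stdSimplex ℝ A

theorem isClosed_seg (π π' : Prob A) : IsClosed (seg π π') := by
  have h : IsCompact (segment ℝ (π : A → ℝ) (π' : A → ℝ)) := by
    rw [segment_eq_image_lineMap]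
    exact isCompact_Icc.image AffineMap.lineMap_continuous
  exact h.isClosed.preimage continuous_subtype_val

end Basic

/-- Information sets: non-empty closed sets of distributions that are finite unions of convex
sets. -/
structure InfoSet (S : Type*) [Fintype S] where
  /-- The underlying set of distributions. -/
  carrier : Set (Prob S)
  nonempty : carrier.Nonempty
  isClosed : IsClosed carrier
  finite_union : ∃ 𝒞 : Set (Set (Prob S)),
    𝒞.Finite ∧ (∀ C ∈ 𝒞, IsConvex C) ∧ carrier = ⋃₀ 𝒞

namespace InfoSet

variable {S : Type*} [Fintype S]

/-- A non-empty, closed and convex set as an information set. -/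
def ofConvex (C : Set (Prob S)) (h₁ : C.Nonempty) (h₂ : IsClosed C) (h₃ : IsConvex C) :
    InfoSet S :=
  ⟨C, h₁, h₂, {C}, Set.finite_singleton C, by simpa using h₃, by simp⟩

/-- No information: `Δ(S)`. -/
def full (S : Type*) [Fintype S] [Nonempty S] : InfoSet S :=
  ofConvex Set.univ Set.univ_nonempty isClosed_univ isConvex_univ

/-- Precise information `{π}`. -/
def single (π : Prob S) : InfoSet S :=
  ofConvex {π} (Set.singleton_nonempty π) isClosed_singleton (isConvex_singleton π)

/-- The information set `{π, π'}`. -/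
def pair (π π' : Prob S) : InfoSet S :=
  ⟨{π, π'}, Set.insert_nonempty _ _, (Set.toFinite {π, π'}).isClosed, {{π}, {π'}},
    Set.toFinite _, by
      rintro C (rfl | rfl)
      · exact isConvex_singleton π
      · exact isConvex_singleton π', by
      ext x
      simp [or_comm]⟩

/-- The information set `[π, π']`. -/
def segm (π π' : Prob S) : InfoSet S :=
  ofConvex (seg π π') ⟨π, left_mem_segment ℝ _ _⟩ (isClosed_seg π π') (isConvex_seg π π')

end InfoSet

/-- Anscombe–Aumann acts: maps from states to lotteries over outcomes. -/
abbrev Act (S X : Type*) [Fintype X] : Type _ := S → Prob X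

section Acts

variable {S X : Type*} [Fintype X]

/-- A lottery viewed as a constant act. -/
def constAct (S : Type*) (p : Prob X) : Act S X := fun _ => p

/-- The statewise mixture `a f + (1 - a) g` of two acts. -/
def mixAct (a : unitInterval) (f g : Act S X) : Act S X := fun s => mix a (f s) (g s)

/-- The act `f E g`, which returns `f s` for `s ∈ E` and `g s` for `s ∉ E`. -/
def pasteAct [DecidableEq S] (E : Finset S) (f g : Act S X) : Act S X :=
  fun s => if s ∈ E then f s else g s

/-- The asymmetric part of a preference relation. -/
def Strict (R : Act S X → Act S X → Prop) (f g : Act S X) : Prop := R f g ∧ ¬ R g f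

/-- The symmetric part of a preference relation. -/
def Indiff (R : Act S X → Act S X → Prop) (f g : Act S X) : Prop := R f g ∧ R g f

/-- The expected utility `u(p)` of a lottery. -/
def eu (u : X → ℝ) (p : Prob X) : ℝ := ∑ x, (p : X → ℝ) x * u x

/-- The subjective expected utility of an act under the belief `π`. -/
def seu [Fintype S] (u : X → ℝ) (π : Prob S) (f : Act S X) : ℝ :=
  ∑ s, (π : S → ℝ) s * eu u (f s)

end Acts

/-- A family of binary relations on acts, indexed by information sets. -/
abbrev PrefFamily (S X : Type*) [Fintype S] [Fintype X] : Type _ :=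
  InfoSet S → Act S X → Act S X → Prop

section Axioms

variable {S X : Type*} [Fintype S] [Nonempty S] [DecidableEq S] [Fintype X]

/-- Standard Postulates. -/
structure StandardPostulates (pref : PrefFamily S X) : Prop where
  complete : ∀ I f g, pref I f g ∨ pref I g f
  transitive : ∀ I f g h, pref I f g → pref I g h → pref I f h
  archimedean : ∀ I f g h, Strict (pref I) f g → Strict (pref I) g h →
    ∃ a b : unitInterval, (0 < a ∧ a < 1) ∧ (0 < b ∧ b < 1) ∧
      Strict (pref I) (mixAct a f h) g ∧ Strict (pref I) g (mixAct b f h)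
  monotone : ∀ I f g, (∀ s, pref I (constAct S (f s)) (constAct S (g s))) → pref I f g
  strict_monotone : ∀ f g : Act S X,
    (∀ s, pref (InfoSet.full S) (constAct S (f s)) (constAct S (g s))) →
    (∃ s, Strict (pref (InfoSet.full S)) (constAct S (f s)) (constAct S (g s))) →
    Strict (pref (InfoSet.full S)) f g
  nontrivial : ∀ I, ∃ f g, Strict (pref I) f g
  independence : ∀ I f g h, ∀ a : unitInterval, 0 < a →
    (pref I f g ↔ pref I (mixAct a f h) (mixAct a g h))
  invariant_risk : ∀ I, ∀ p q : Prob X,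
    (pref I (constAct S p) (constAct S q) ↔
      pref (InfoSet.full S) (constAct S p) (constAct S q))

/-- Compliance. -/
def Compliance (pref : PrefFamily S X) : Prop :=
  ∀ (p q : Prob X) (E : Finset S) (π : Prob S),
    Indiff (pref (InfoSet.single π)) (pasteAct E (constAct S p) (constAct S q))
      (constAct S (mix (probOf π E) p q))

/-- Responsiveness. -/
def Responsiveness (pref : PrefFamily S X) : Prop :=
  ∀ I I' : InfoSet S, pref I = pref I' → (I.carrier ∩ I'.carrier).Nonempty

/-- Informational Betweenness. -/
def InformationalBetweenness (pref : PrefFamily S X) : Prop :=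
  ∀ I₁ I₂ I' : InfoSet S, I₂.carrier ⊆ I'.carrier → I'.carrier ⊆ I₁.carrier →
    pref I₁ = pref I₂ → pref I₁ = pref I'

/-- Extremeness; the interior is taken in the space `Δ(S)`. -/
def Extremeness (pref : PrefFamily S X) : Prop :=
  ∀ I I' : InfoSet S, IsConvex I.carrier → IsConvex I'.carrier →
    I'.carrier ⊆ interior I.carrier → pref I ≠ pref (InfoSet.full S) → pref I' ≠ pref I

/-- Weak Continuity. -/
def WeakContinuity (pref : PrefFamily S X) : Prop :=
  ∀ π π' : Prob S, π ≠ π' → pref (InfoSet.segm π π') = pref (InfoSet.single π) →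
    ∃ ε : ℝ, 0 < ε ∧ ∀ π'' : Prob S, eucl π' π'' < ε →
      pref (InfoSet.pair π π'') = pref (InfoSet.single π)

/-- The six axioms together. -/
structure SatisfiesAxioms (pref : PrefFamily S X) : Prop where
  standard : StandardPostulates pref
  compliance : Compliance pref
  responsiveness : Responsiveness pref
  betweenness : InformationalBetweenness pref
  extremeness : Extremeness pref
  weakContinuity : WeakContinuity pref

end Axioms

section Representation

variable {S X : Type*} [Fintype S] [Fintype X]

/-- `d` is a distance function with respect to `μ`. -/
structure IsDistance (μ : Prob S) (d : Prob S → ℝ) : Prop where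
  mix_lt : ∀ π π' : Prob S, π ≠ π' → d π = d π' →
    ∃ a : unitInterval, 0 < a ∧ a < 1 ∧ d (mix a π π') < d π
  lt_of_ne : ∀ π : Prob S, π ≠ μ → d μ < d π

/-- `r` (read `r π π'` as `π ≻ π'`) is a tie-breaker for `d`: a strict total order such that
`d π > d π'` implies `π ≻ π'`. -/
structure IsTieBreaker (d : Prob S → ℝ) (r : Prob S → Prob S → Prop) : Prop where
  strictTotal : IsStrictTotalOrder (Prob S) r
  of_lt : ∀ π π' : Prob S, d π' < d π → r π π'

/-- `d` is locally nonsatiated with respect to `μ`. -/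
def LocallyNonsatiated (μ : Prob S) (d : Prob S → ℝ) : Prop :=
  ∀ π : Prob S, π ≠ μ → ∀ ε : ℝ, 0 < ε → ∃ π' : Prob S, eucl π π' < ε ∧ d π' < d π

/-- `d` is weakly continuous. -/
def WeaklyContinuous (d : Prob S → ℝ) : Prop :=
  ∀ π π' : Prob S, d π < d π' →
    ∃ ε : ℝ, 0 < ε ∧ ∀ π'' : Prob S, eucl π' π'' < ε → d π < d π''

/-- `arg min d(I)`. -/
def argMin (d : Prob S → ℝ) (I : Set (Prob S)) : Set (Prob S) :=
  {x | x ∈ I ∧ ∀ y ∈ I, d x ≤ d y}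

/-- `min(B, ≻)`: the elements of `B` below all other elements of `B`. -/
def minOf (B : Set (Prob S)) (r : Prob S → Prob S → Prop) : Set (Prob S) :=
  {x | x ∈ B ∧ ∀ y ∈ B, y ≠ x → r y x}

/-- The family `pref` is represented by Inertial Updating with a nonconstant Bernoulli utility
`u`, a full-support prior `μ`, a distance function `d` with respect to `μ` and a tie-breaker `r`:
for each information set `I`, there is a posterior `μI` with `{μI} = min(arg min d(I), ≻)`, and
`(u, μI)` is a subjective expected utility representation of `pref I`. -/
structure IsInertialUpdating (pref : PrefFamily S X) (u : X → ℝ) (μ : Prob S) (d : Prob S → ℝ)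
    (r : Prob S → Prob S → Prop) : Prop where
  nonconstant : ∃ x y, u x ≠ u y
  fullSupport : ∀ s, 0 < (μ : S → ℝ) s
  distance : IsDistance μ d
  tieBreaker : IsTieBreaker d r
  represents : ∀ I : InfoSet S, ∃ μI : Prob S,
    minOf (argMin d I.carrier) r = {μI} ∧
    ∀ f g : Act S X, pref I f g ↔ seu u μI g ≤ seu u μI f

end Representation

end InertialUpdating

open InertialUpdating

namespace InertialUpdating

/-! ### Mixtures of lotteries and affine functions on the simplex. -/

section Mixtures

variable {A : Type*} [Fintype A]

/-! The axioms reduce to a choice problem on beliefs. The Standard Postulates give every preference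
an expected utility representation with one common utility and a belief `c I`
(`StandardPostulates.exists_seuPref`). Since beliefs are identified by preferences
(`seuPref_injective`), equality of preferences means equality of the beliefs `c I`. Compliance then
says that `c` fixes singletons, Responsiveness that `c I` lies in `I`, and Informational Betweenness
that `c` satisfies independence of irrelevant alternatives, so choices from pairs form a strict
total order and `c I` is its least element in `I`.

The order itself serves as tie-breaker. What remains is a real-valued `d` that is weakly monotone
for it and separates enough points (`IsConsistent.exists_distance`). Weak Continuity makes `d`
strict between the choice from a segment and an endpoint that is not chosen; hence tied points have
a strictly better point between them. Extremeness keeps the choice from a small ball around `π ≠ μ`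
away from `π`, which gives local nonsatiation.

Conversely, the posterior is the least element of `I` for the tie-breaker, because the tie-breaker
refines `d`; the axioms are then statements about this minimiser. -/

theorem mix_apply (a : unitInterval) (p q : Prob A) (x : A) :
    (mix a p q : A → ℝ) x = a * (p : A → ℝ) x + (1 - a) * (q : A → ℝ) x := rfl

theorem prob_ext {p q : Prob A} (h : ∀ x, (p : A → ℝ) x = (q : A → ℝ) x) : p = q :=
  Subtype.ext (funext h)

theorem mix_self (a : unitInterval) (p : Prob A) : mix a p p = p :=
  prob_ext fun x => by rw [mix_apply]; ring

theorem mix_one (p q : Prob A) : mix 1 p q = p :=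
  prob_ext fun x => by rw [mix_apply]; simp

theorem mix_zero (p q : Prob A) : mix 0 p q = q :=
  prob_ext fun x => by rw [mix_apply]; simp

theorem sum_prob (p : Prob A) : ∑ x, (p : A → ℝ) x = 1 := p.2.2

/-- The degenerate lottery at `x`. -/
noncomputable def dirac (x : A) : Prob A :=
  ⟨fun y => open Classical in if x = y then 1 else 0, by
    classical
    exact ite_eq_mem_stdSimplex ℝ x⟩

/-- A property of distributions that is closed under mixtures and holds at the vertices of the
simplex holds everywhere. -/
theorem prob_induction {P : Prob A → Prop} (h₁ : ∀ x, P (dirac x))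
    (h₂ : ∀ a p q, P p → P q → P (mix a p q)) (p : Prob A) : P p := by
  classical
  have hc : Convex ℝ (Subtype.val '' {p : Prob A | P p}) := by
    rintro _ ⟨p, hp, rfl⟩ _ ⟨q, hq, rfl⟩ a b ha hb hab
    obtain rfl : b = 1 - a := eq_sub_iff_add_eq'.2 hab
    exact ⟨mix ⟨a, ha, sub_nonneg.1 hb⟩ p q, h₂ _ _ _ hp hq, rfl⟩
  have hs : stdSimplex ℝ A ⊆ Subtype.val '' {p : Prob A | P p} := by
    refine (convexHull_basis_eq_stdSimplex ℝ A).symm.subset.trans (convexHull_min ?_ hc)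
    rintro _ ⟨x, rfl⟩
    refine ⟨dirac x, h₁ x, ?_⟩
    ext y
    simp only [dirac]
  obtain ⟨q, hq, hqp⟩ := hs p.2
  rwa [← Subtype.ext hqp]

theorem eu_mix (u : A → ℝ) (a : unitInterval) (p q : Prob A) :
    eu u (mix a p q) = a * eu u p + (1 - a) * eu u q := by
  simp only [eu, mix_apply, Finset.mul_sum, ← Finset.sum_add_distrib]
  exact Finset.sum_congr rfl fun x _ => by ring

open Classical in
theorem dirac_apply (x y : A) : (dirac x : A → ℝ) y = if x = y then 1 else 0 := rfl

theorem eu_dirac (u : A → ℝ) (x : A) : eu u (dirac x) = u x := by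
  classical
  simp [eu, dirac_apply]

/-- An affine function on a simplex is determined by its values at the vertices. -/
theorem eq_eu_of_affine {v : Prob A → ℝ}
    (hv : ∀ a p q, v (mix a p q) = a * v p + (1 - a) * v q) (p : Prob A) :
    v p = eu (fun x => v (dirac x)) p := by
  refine prob_induction (P := fun p => v p = eu (fun x => v (dirac x)) p) ?_ ?_ p
  · intro x
    rw [eu_dirac]
  · intro a p q hp hq
    rw [hv, eu_mix, hp, hq]

end Mixtures

/-! ### Expected utility preferences and identification of beliefs. -/

section ExpectedUtility

variable {S X : Type*} [Fintype S] [Fintype X]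

theorem seu_constAct (u : X → ℝ) (π : Prob S) (p : Prob X) :
    seu u π (constAct S p) = eu u p := by
  simp only [seu, constAct, ← Finset.sum_mul]
  rw [sum_prob, one_mul]

theorem seu_mixAct (u : X → ℝ) (π : Prob S) (a : unitInterval) (f g : Act S X) :
    seu u π (mixAct a f g) = a * seu u π f + (1 - a) * seu u π g := by
  simp only [seu, mixAct, eu_mix, Finset.mul_sum, ← Finset.sum_add_distrib]
  exact Finset.sum_congr rfl fun s _ => by ring

theorem probOf_coe (π : Prob S) (E : Finset S) : (probOf π E : ℝ) = ∑ s ∈ E, (π : S → ℝ) s := rfl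

theorem seu_pasteAct [DecidableEq S] (u : X → ℝ) (π : Prob S) (E : Finset S) (p q : Prob X) :
    seu u π (pasteAct E (constAct S p) (constAct S q))
      = probOf π E * eu u p + (1 - probOf π E) * eu u q := by
  have h : ∀ s, (π : S → ℝ) s * eu u (pasteAct E (constAct S p) (constAct S q) s)
      = (if s ∈ E then (π : S → ℝ) s else 0) * (eu u p - eu u q) + (π : S → ℝ) s * eu u q := by
    intro s
    by_cases hs : s ∈ E <;> simp [pasteAct, constAct, hs]
    ring
  simp only [seu, h, Finset.sum_add_distrib, ← Finset.sum_mul]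
  rw [sum_prob, probOf_coe, Finset.sum_ite_mem, Finset.univ_inter]
  ring

/-- The subjective expected utility preference of the belief `π`. -/
def seuPref (u : X → ℝ) (π : Prob S) (f g : Act S X) : Prop := seu u π g ≤ seu u π f

theorem strict_seuPref {u : X → ℝ} {π : Prob S} {f g : Act S X} :
    Strict (seuPref u π) f g ↔ seu u π g < seu u π f := by
  simp only [Strict, seuPref, not_le]
  exact ⟨fun h => h.2, fun h => ⟨h.le, h⟩⟩

theorem indiff_seuPref {u : X → ℝ} {π : Prob S} {f g : Act S X} :
    Indiff (seuPref u π) f g ↔ seu u π f = seu u π g := by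
  simp only [Indiff, seuPref]
  exact ⟨fun h => le_antisymm h.2 h.1, fun h => ⟨h.ge, h.le⟩⟩

theorem compliance_seuPref [DecidableEq S] (u : X → ℝ) (π : Prob S) (p q : Prob X)
    (E : Finset S) :
    Indiff (seuPref u π) (pasteAct E (constAct S p) (constAct S q))
      (constAct S (mix (probOf π E) p q)) := by
  rw [indiff_seuPref, seu_pasteAct, seu_constAct, eu_mix]

/-- A belief is identified by how it evaluates bets on states. -/
theorem belief_eq_of_compliance [DecidableEq S] {u : X → ℝ} {x y : X} (hu : u x ≠ u y)
    {π ν : Prob S}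
    (h : ∀ (p q : Prob X) (E : Finset S),
      Indiff (seuPref u ν) (pasteAct E (constAct S p) (constAct S q))
        (constAct S (mix (probOf π E) p q))) : ν = π := by
  refine prob_ext fun s => ?_
  have := h (dirac x) (dirac y) {s}
  rw [indiff_seuPref, seu_pasteAct, seu_constAct, eu_mix, eu_dirac, eu_dirac, probOf_coe,
    probOf_coe, Finset.sum_singleton, Finset.sum_singleton] at this
  have h0 : ((ν : S → ℝ) s - (π : S → ℝ) s) * (u x - u y) = 0 := by linear_combination this
  rcases mul_eq_zero.1 h0 with h1 | h1
  · linarith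
  · exact absurd (by linarith) hu

theorem seuPref_injective {u : X → ℝ} {x y : X} (hu : u x ≠ u y) {π ν : Prob S}
    (h : (seuPref u π : Act S X → Act S X → Prop) = seuPref u ν) : π = ν := by
  classical
  refine (belief_eq_of_compliance hu fun p q E => ?_).symm
  rw [← h]
  exact compliance_seuPref u π p q E

end ExpectedUtility

/-! ### Choice from information sets, the revealed ranking and the distance. -/

section Choice

variable {S : Type*} [Fintype S]

theorem mem_seg_mix (a : unitInterval) (x y : Prob S) : mix a x y ∈ seg x y :=
  ⟨a, 1 - a, a.2.1, sub_nonneg.2 a.2.2, by ring, rfl⟩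

theorem left_mem_seg (x y : Prob S) : x ∈ seg x y := left_mem_segment ℝ _ _

theorem right_mem_seg (x y : Prob S) : y ∈ seg x y := right_mem_segment ℝ _ _

theorem exists_mix_of_mem_seg {x y z : Prob S} (hz : z ∈ seg x y) (hx : z ≠ x) (hy : z ≠ y) :
    ∃ a : unitInterval, 0 < a ∧ a < 1 ∧ z = mix a x y := by
  obtain ⟨a, b, ha, hb, hab, h⟩ := hz
  have hb' : b = 1 - a := by linarith
  subst hb'
  refine ⟨⟨a, ha, by linarith⟩, ?_, ?_, Subtype.ext h.symm⟩
  · refine lt_of_le_of_ne ha fun h0 => hy (DFunLike.coe_injective ?_)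
    have h0' : (0 : ℝ) = a := congrArg Subtype.val h0
    rw [← h, ← h0']
    simp
  · refine lt_of_le_of_ne (show a ≤ 1 by linarith) fun h0 => hx (DFunLike.coe_injective ?_)
    have h0' : a = 1 := congrArg Subtype.val h0
    rw [← h, h0']
    simp

theorem IsConvex.seg_subset {C : Set (Prob S)} (hC : IsConvex C) {x y : Prob S} (hx : x ∈ C)
    (hy : y ∈ C) : seg x y ⊆ C := by
  intro z hz
  obtain ⟨w, hw, hwz⟩ := hC.segment_subset (Set.mem_image_of_mem _ hx)
    (Set.mem_image_of_mem _ hy) hz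
  rwa [← Subtype.ext hwz]

/-- The metric on `Prob S` comes from the sup norm; this bound relates it to the Euclidean norm of
the axioms. -/
theorem dist_le_eucl (x y : Prob S) : dist x y ≤ eucl x y := by
  rw [Subtype.dist_eq, dist_eq_norm]
  refine (pi_norm_le_iff_of_nonneg (norm_nonneg _)).2 fun s => ?_
  exact PiLp.norm_apply_le (WithLp.toLp 2 ((x : S → ℝ) - (y : S → ℝ))) s

theorem eucl_self (x : Prob S) : eucl x x = 0 := by simp [eucl]

theorem continuous_eucl (x : Prob S) : Continuous (eucl x) := by
  unfold eucl
  exact ((PiLp.continuous_toLp 2 _).comp (continuous_const.sub continuous_subtype_val)).norm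

theorem eucl_lt_mem_nhds (x : Prob S) {ε : ℝ} (hε : 0 < ε) : {y | eucl x y < ε} ∈ nhds x :=
  (isOpen_lt (continuous_eucl x) continuous_const).mem_nhds (by simpa [eucl_self] using hε)

theorem exists_eucl_lt_subset {x : Prob S} {U : Set (Prob S)} (hU : U ∈ nhds x) :
    ∃ ε > 0, ∀ y, eucl x y < ε → y ∈ U := by
  obtain ⟨ε, hε, h⟩ := Metric.mem_nhds_iff.1 hU
  refine ⟨ε, hε, fun y hy => h ?_⟩
  rw [Metric.mem_ball, dist_comm]
  exact (dist_le_eucl x y).trans_lt hy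

theorem isConvex_closedBall (x : Prob S) (δ : ℝ) : IsConvex (Metric.closedBall x δ) := by
  have h : (fun π : Prob S => (π : S → ℝ)) '' Metric.closedBall x δ
      = stdSimplex ℝ S ∩ Metric.closedBall (x : S → ℝ) δ := by
    ext y
    constructor
    · rintro ⟨z, hz, rfl⟩
      exact ⟨z.2, hz⟩
    · rintro ⟨hy, hyx⟩
      exact ⟨⟨y, hy⟩, hyx, rfl⟩
  unfold IsConvex
  rw [h]
  exact (convex_stdSimplex ℝ S).inter (convex_closedBall _ _)

/-- A finite non-empty set of distributions, as an information set. -/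
def InfoSet.ofFinite (T : Set (Prob S)) (hT : T.Finite) (hne : T.Nonempty) : InfoSet S :=
  ⟨T, hne, hT.isClosed, (fun x => {x}) '' T, hT.image _, by
    rintro _ ⟨x, _, rfl⟩
    exact isConvex_singleton x, by simp⟩

variable (c : InfoSet S → Prob S)

/-- `x` is revealed closer than `y` by the choice function `c`. -/
def Closer (x y : Prob S) : Prop := x ≠ y ∧ c (InfoSet.pair x y) = x

/-- A choice function satisfying the independence of irrelevant alternatives. -/
structure IsConsistent : Prop where
  mem : ∀ I, c I ∈ I.carrier
  iia : ∀ I J : InfoSet S, J.carrier ⊆ I.carrier → c I ∈ J.carrier → c J = c I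

variable {c}

namespace IsConsistent

variable (h : IsConsistent c)
include h

theorem pair_comm (x y : Prob S) : c (InfoSet.pair x y) = c (InfoSet.pair y x) :=
  h.iia _ _ (Set.pair_comm x y).subset ((Set.pair_comm y x).subset (h.mem (InfoSet.pair y x)))

theorem closer_of_mem {I : InfoSet S} {y : Prob S} (hy : y ∈ I.carrier) (hne : y ≠ c I) :
    Closer c (c I) y :=
  ⟨hne.symm, h.iia I _ (Set.insert_subset (h.mem I) (Set.singleton_subset_iff.2 hy))
    (Set.mem_insert _ _)⟩

theorem closer_asymm {x y : Prob S} (hxy : Closer c x y) : ¬ Closer c y x := fun hyx =>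
  hxy.1 (by rw [← hxy.2, h.pair_comm, hyx.2])

theorem closer_total {x y : Prob S} (hne : x ≠ y) : Closer c x y ∨ Closer c y x := by
  rcases h.mem (InfoSet.pair x y) with hx | hy
  · exact Or.inl ⟨hne, hx⟩
  · exact Or.inr ⟨hne.symm, by rw [h.pair_comm]; exact hy⟩

/-- The choice from the triple `{x, y, z}` beats the other two. It cannot be `y`, which loses to
`x`, nor `z`, which loses to `y`, so it is `x`. -/
theorem closer_trans {x y z : Prob S} (hxy : Closer c x y) (hyz : Closer c y z) :
    Closer c x z := by
  have hxz : z ≠ x := by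
    rintro rfl
    exact h.closer_asymm hxy hyz
  let T : InfoSet S := InfoSet.ofFinite {x, y, z} (Set.toFinite _) (Set.insert_nonempty _ _)
  have hx : x ∈ T.carrier := Or.inl rfl
  have hy : y ∈ T.carrier := Or.inr (Or.inl rfl)
  have hz : z ∈ T.carrier := Or.inr (Or.inr rfl)
  rcases h.mem T with hT | hT | hT
  · have := h.closer_of_mem hz (by rw [hT]; exact hxz)
    rwa [hT] at this
  · have := h.closer_of_mem hx (by rw [hT]; exact hxy.1)
    rw [hT] at this
    exact absurd this (h.closer_asymm hxy)
  · have hT' : c T = z := hT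
    have := h.closer_of_mem hy (by rw [hT']; exact hyz.1)
    rw [hT'] at this
    exact absurd this (h.closer_asymm hyz)

theorem isStrictTotalOrder : IsStrictTotalOrder (Prob S) fun x y => Closer c y x where
  trichotomous x y hxy hyx := by
    by_contra hne
    rcases h.closer_total hne with h1 | h1
    · exact hyx h1
    · exact hxy h1
  irrefl x hx := hx.1 rfl
  trans x y z hxy hyz := h.closer_trans hyz hxy

/-- A consistent choice function is rationalized by a distance function that is monotone for the
revealed ranking. It sums weights `2⁻ⁿ` over those sets `B n` of a countable basis that do not lie
entirely beyond the point. -/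
theorem exists_distance (μ : Prob S) (hμ : ∀ I, μ ∈ InfoSet.carrier I → c I = μ)
    (hext : ∀ I : InfoSet S, IsConvex I.carrier → c I ≠ μ → c I ∉ interior I.carrier)
    (hwc : ∀ x y : Prob S, x ≠ y → c (InfoSet.segm x y) = x →
      ∃ ε : ℝ, 0 < ε ∧ ∀ z, eucl y z < ε → c (InfoSet.pair x z) = x) :
    ∃ d : Prob S → ℝ, IsDistance μ d ∧ IsTieBreaker d (fun x y => Closer c y x) ∧
      LocallyNonsatiated μ d ∧
      ∀ I : InfoSet S, minOf (argMin d I.carrier) (fun x y => Closer c y x) = {c I} := by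
  classical
  -- Enumerating the basis needs it to be nonempty; a basic set around `μ` serves as witness.
  obtain ⟨B, hB⟩ := (TopologicalSpace.countable_countableBasis (Prob S)).exists_eq_range
    ⟨_, ((TopologicalSpace.isBasis_countableBasis (Prob S)).mem_nhds_iff.1
      (Filter.univ_mem : Set.univ ∈ nhds μ)).choose_spec.1⟩
  let t : Prob S → ℕ → ℝ := fun x n => if ∀ y ∈ B n, Closer c x y then 0 else (1 / 2) ^ n
  have ht : ∀ x, Summable (t x) := fun x => by
    refine Summable.of_nonneg_of_le (fun n => ?_) (fun n => ?_) summable_geometric_two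
    · simp only [t]; split_ifs <;> positivity
    · simp only [t]; split_ifs
      · positivity
      · exact le_rfl
  have hle : ∀ x y, Closer c x y → ∀ n, t x n ≤ t y n := by
    intro x y hxy n
    simp only [t]
    split_ifs with h1 h2 h2
    · exact le_rfl
    · positivity
    · exact absurd (fun z hz => h.closer_trans hxy (h2 z hz)) h1
    · exact le_rfl
  let d : Prob S → ℝ := fun x => ∑' n, t x n
  have hmono : ∀ x y, Closer c x y → d x ≤ d y := fun x y hxy =>
    (ht x).tsum_le_tsum (hle x y hxy) (ht y)
  -- Weak Continuity puts a whole basic neighbourhood of `y` beyond `x`. Its term vanishes at `x`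
  -- but not at `y`, since `y` is not closer than itself. The point `x` is removed from the
  -- neighbourhood because `Closer` requires distinct points.
  have hlt : ∀ x y, x ≠ y → c (InfoSet.segm x y) = x → d x < d y := by
    intro x y hne hx
    obtain ⟨ε, hε, hε'⟩ := hwc x y hne hx
    have hU : {z | eucl y z < ε} ∩ {x}ᶜ ∈ nhds y :=
      Filter.inter_mem (eucl_lt_mem_nhds y hε) (isOpen_compl_singleton.mem_nhds hne.symm)
    obtain ⟨V, hV, hyV, hVU⟩ :=
      (TopologicalSpace.isBasis_countableBasis (Prob S)).mem_nhds_iff.1 hU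
    rw [hB] at hV
    obtain ⟨n, rfl⟩ := hV
    have hxy : Closer c x y := by
      have := h.closer_of_mem (I := InfoSet.segm x y) (right_mem_seg x y)
        (by rw [hx]; exact hne.symm)
      rwa [hx] at this
    refine Summable.tsum_lt_tsum (i := n) (hle x y hxy) ?_ (ht x) (ht y)
    have h1 : ∀ z ∈ B n, Closer c x z := fun z hz => ⟨fun h => (hVU hz).2 h.symm, hε' z (hVU hz).1⟩
    have h2 : ¬ ∀ z ∈ B n, Closer c y z := fun h => (h y hyV).1 rfl
    simp only [t, if_pos h1, if_neg h2]
    positivity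
  -- By independence of irrelevant alternatives, the choice from a convex set is also the choice
  -- from each segment joining it to another point of the set.
  have hconv : ∀ I : InfoSet S, IsConvex I.carrier → ∀ y ∈ I.carrier, c I ≠ y → d (c I) < d y :=
    fun I hI y hy hne => hlt _ _ hne
      (h.iia I _ (hI.seg_subset (h.mem I) hy) (left_mem_seg _ _))
  refine ⟨d, ⟨?_, ?_⟩, ⟨h.isStrictTotalOrder, ?_⟩, ?_, ?_⟩
  · intro x y hne hd
    -- A tie rules out both endpoints as the choice from the segment, so the choice is a proper
    -- mixture, and it is strictly nearer.
    have hx : c (InfoSet.segm x y) ≠ x := fun hx => (hlt x y hne hx).ne hd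
    have hy : c (InfoSet.segm x y) ≠ y := fun hy => by
      have := hconv (InfoSet.segm x y) (isConvex_seg x y) x (left_mem_seg x y)
        (by rwa [hy, ne_comm])
      rw [hy] at this
      exact this.ne hd.symm
    obtain ⟨a, h0, h1, ha⟩ := exists_mix_of_mem_seg (h.mem (InfoSet.segm x y)) hx hy
    refine ⟨a, h0, h1, ?_⟩
    rw [← ha]
    exact hconv _ (isConvex_seg x y) x (left_mem_seg x y) hx
  · intro x hx
    exact hlt μ x hx.symm (hμ _ (left_mem_seg μ x))
  · intro x y hd
    have hne : y ≠ x := by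
      rintro rfl
      exact hd.ne rfl
    rcases h.closer_total hne with h1 | h1
    · exact h1
    · exact absurd (hmono x y h1) hd.not_ge
  · intro x hx ε hε
    obtain ⟨δ, hδ, hball⟩ := Metric.nhds_basis_closedBall.mem_iff.1 (eucl_lt_mem_nhds x hε)
    -- A closed sup-norm ball inside the Euclidean one: it is convex with `x` in its interior, so
    -- Extremeness forbids choosing `x ≠ μ` from it.
    let I : InfoSet S := InfoSet.ofConvex (Metric.closedBall x δ)
      ⟨x, Metric.mem_closedBall_self hδ.le⟩ Metric.isClosed_closedBall (isConvex_closedBall x δ)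
    have hI : IsConvex I.carrier := isConvex_closedBall x δ
    have hxI : x ∈ interior I.carrier :=
      Metric.ball_subset_interior_closedBall (Metric.mem_ball_self hδ)
    refine ⟨c I, hball (h.mem I), hconv I hI x (interior_subset hxI) ?_⟩
    intro hcx
    exact hext I hI (by rwa [hcx]) (by rwa [hcx])
  · intro I
    have hmem : c I ∈ argMin d I.carrier := ⟨h.mem I, fun y hy => by
      rcases eq_or_ne y (c I) with rfl | hne
      · exact le_rfl
      · exact hmono _ _ (h.closer_of_mem hy hne)⟩
    ext x
    constructor
    · rintro ⟨hx, hx'⟩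
      by_contra hne
      exact h.closer_asymm (hx' _ hmem fun h' => hne h'.symm) (h.closer_of_mem hx.1 hne)
    · rintro rfl
      exact ⟨hmem, fun y hy hne => h.closer_of_mem hy.1 hne⟩

end IsConsistent

end Choice

/-! ### The Anscombe–Aumann representation through equivalent bets. -/

section AnscombeAumann

variable {S X : Type*} [Fintype X]

theorem mixAct_comm (a : unitInterval) (f g : Act S X) :
    mixAct a f g = mixAct (unitInterval.symm a) g f := by
  funext s
  refine prob_ext fun x => ?_
  simp only [mixAct, mix_apply, unitInterval.coe_symm_eq]
  ring

theorem mixAct_self (a : unitInterval) (f : Act S X) : mixAct a f f = f :=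
  funext fun _ => mix_self a _

theorem mixAct_zero (f g : Act S X) : mixAct 0 f g = g := funext fun _ => mix_zero _ _

/-- The bet that pays the lottery `p` with chance `t` and `q` otherwise. -/
def bet (S : Type*) (p q : Prob X) (t : unitInterval) : Act S X := constAct S (mix t p q)

theorem bet_one (p q : Prob X) : bet S p q 1 = constAct S p := by rw [bet, mix_one]

theorem bet_zero (p q : Prob X) : bet S p q 0 = constAct S q := by rw [bet, mix_zero]

theorem mixAct_bet {p q : Prob X} {a s t r : unitInterval}
    (h : (r : ℝ) = a * s + (1 - a) * t) :
    mixAct a (bet S p q s) (bet S p q t) = bet S p q r := by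
  funext i
  refine prob_ext fun x => ?_
  simp only [mixAct, bet, constAct, mix_apply, h]
  ring

/-- A preference satisfying the von Neumann-Morgenstern axioms and statewise monotonicity. -/
structure IsRational (R : Act S X → Act S X → Prop) : Prop where
  complete : ∀ f g, R f g ∨ R g f
  trans : ∀ f g h, R f g → R g h → R f h
  archimedean : ∀ f g h, Strict R f g → Strict R g h →
    ∃ a b : unitInterval, (0 < a ∧ a < 1) ∧ (0 < b ∧ b < 1) ∧
      Strict R (mixAct a f h) g ∧ Strict R g (mixAct b f h)
  monotone : ∀ f g, (∀ s, R (constAct S (f s)) (constAct S (g s))) → R f g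
  independence : ∀ f g h, ∀ a : unitInterval, 0 < a →
    (R f g ↔ R (mixAct a f h) (mixAct a g h))

namespace IsRational

variable {R : Act S X → Act S X → Prop} (h : IsRational R)
include h

theorem refl (f : Act S X) : R f f := (h.complete f f).elim id id

theorem strict_of_not {f g : Act S X} (hn : ¬ R g f) : Strict R f g :=
  ⟨(h.complete f g).resolve_right hn, hn⟩

theorem mixAct_left {f f' : Act S X} (hf : R f f') (a : unitInterval) (g : Act S X) :
    R (mixAct a f g) (mixAct a f' g) := by
  rcases (unitInterval.nonneg' (t := a)).eq_or_lt with h0 | h0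
  · rw [← h0, mixAct_zero, mixAct_zero]
    exact h.refl g
  · exact (h.independence _ _ _ a h0).1 hf

theorem mixAct_congr {f f' g g' : Act S X} (hf : R f f') (hg : R g g') (a : unitInterval) :
    R (mixAct a f g) (mixAct a f' g') := by
  refine h.trans _ _ _ (h.mixAct_left hf a g) ?_
  rw [mixAct_comm a f' g, mixAct_comm a f' g']
  exact h.mixAct_left hg _ _

end IsRational

/-- A rational preference with a best constant act `p` and a worst constant act `q`. -/
structure IsBoundedRational (R : Act S X → Act S X → Prop) (p q : Prob X) : Prop
    extends IsRational R where
  best : ∀ r, R (constAct S p) (constAct S r)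
  worst : ∀ r, R (constAct S r) (constAct S q)
  nontrivial : ¬ R (constAct S q) (constAct S p)

namespace IsBoundedRational

variable {R : Act S X → Act S X → Prop} {p q : Prob X} (h : IsBoundedRational R p q)
include h

theorem best_act (f : Act S X) : R (constAct S p) f := h.monotone _ _ fun _ => h.best _

theorem worst_act (f : Act S X) : R f (constAct S q) := h.monotone _ _ fun _ => h.worst _

theorem not_bet_of_lt {s t : unitInterval} (hst : s < t) : ¬ R (bet S p q s) (bet S p q t) := by
  have hst' : (s : ℝ) < t := hst
  have ht : (0 : ℝ) < t := s.2.1.trans_lt hst'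
  have h1 : ¬ R (constAct S q) (bet S p q t) := by
    have := (h.independence _ _ (constAct S q) t (show 0 < t from ht)).not.1 h.nontrivial
    rwa [mixAct_self] at this
  -- With weight `1 - s / t` on `q`, mixing `q` into the bet `t` gives the bet `s`, and independence
  -- transfers the strict ranking.
  have ha0 : 0 < 1 - (s : ℝ) / t := sub_pos.2 ((div_lt_one ht).2 hst')
  have ha1 : 1 - (s : ℝ) / t ≤ 1 := sub_le_self _ (div_nonneg s.2.1 ht.le)
  have h2 := (h.independence _ _ (bet S p q t) ⟨_, ha0.le, ha1⟩ ha0).not.1 h1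
  rw [mixAct_self, ← bet_zero (S := S) p q, mixAct_bet (r := s)] at h2
  · exact h2
  · simp
    field_simp

theorem bet_iff {s t : unitInterval} : R (bet S p q s) (bet S p q t) ↔ t ≤ s := by
  refine ⟨fun hR => not_lt.1 fun hlt => h.not_bet_of_lt hlt hR, fun hle => ?_⟩
  rcases hle.eq_or_lt with rfl | hlt
  · exact h.refl _
  · exact (h.complete _ _).resolve_right (h.not_bet_of_lt hlt)

/-- The equivalent bet is the supremum of the bets weakly worse than `f`; the Archimedean axiom
excludes a strict ranking in either direction. -/
theorem exists_indiff_bet (f : Act S X) : ∃ t, Indiff R f (bet S p q t) := by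
  let A : Set unitInterval := {t | R f (bet S p q t)}
  have hA : IsLUB A (sSup A) := isLUB_sSup A
  generalize sSup A = t at hA
  refine ⟨t, ?_, ?_⟩
  · by_contra hn
    have ht : 0 < t := by
      refine unitInterval.pos_iff_ne_zero.2 fun h0 => hn ?_
      rw [h0, bet_zero]
      exact h.worst_act f
    by_cases hw : R (constAct S q) f
    · refine ht.not_ge (hA.2 fun r hr => ?_)
      rw [← h.bet_iff, bet_zero]
      exact h.trans _ _ _ hw hr
    -- If the bet `t` beats `f`, so does the bet `a * t` for some `a < 1`, a smaller upper bound of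
    -- `A`.
    · obtain ⟨a, -, ⟨_, ha⟩, -, hS, -⟩ :=
        h.archimedean _ _ _ (h.strict_of_not hn) (h.strict_of_not hw)
      rw [← bet_zero (S := S) p q, mixAct_bet (r := a * t) (by simp)] at hS
      have hle : t ≤ a * t := hA.2 fun r hr => h.bet_iff.1 (h.trans _ _ _ hS.1 hr)
      have hle' : (t : ℝ) ≤ a * t := hle
      have ha' : (a : ℝ) < 1 := ha
      have ht' : (0 : ℝ) < t := ht
      nlinarith
  · by_contra hn
    have ht : t < 1 := by
      refine unitInterval.lt_one_iff_ne_one.2 fun h0 => hn ?_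
      rw [h0, bet_one]
      exact h.best_act f
    by_cases hb : R f (constAct S p)
    · refine ht.not_ge (hA.1 ?_)
      change R f (bet S p q 1)
      rwa [bet_one]
    -- If `f` beats the bet `t`, it also beats a mixture of that bet with `p`, which is a larger bet
    -- in `A`.
    · obtain ⟨-, a, -, ⟨ha, _⟩, -, hS⟩ :=
        h.archimedean _ _ _ (h.strict_of_not hb) (h.strict_of_not hn)
      have ha' : (0 : ℝ) < a := ha
      have ht' : (t : ℝ) < 1 := ht
      have hr := (convex_Icc (0 : ℝ) 1) (unitInterval.one_mem) t.2 a.2.1 (sub_nonneg.2 a.2.2) (by ring)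
      rw [← bet_one (S := S) p q, mixAct_bet (r := ⟨_, hr⟩) (by simp)] at hS
      have hle : (⟨_, hr⟩ : unitInterval) ≤ t := hA.1 hS.1
      have hle' : (a : ℝ) • (1 : ℝ) + (1 - (a : ℝ)) • (t : ℝ) ≤ t := hle
      simp only [smul_eq_mul] at hle'
      nlinarith

/-- The chance of the best lottery that makes the bet indifferent to `f`. -/
noncomputable def val (f : Act S X) : unitInterval := (h.exists_indiff_bet f).choose

theorem indiff_bet_val (f : Act S X) : Indiff R f (bet S p q (h.val f)) :=
  (h.exists_indiff_bet f).choose_spec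

theorem rel_iff_val_le {f g : Act S X} : R f g ↔ h.val g ≤ h.val f := by
  rw [← h.bet_iff]
  constructor
  · intro hR
    exact h.trans _ _ _ (h.indiff_bet_val f).2 (h.trans _ _ _ hR (h.indiff_bet_val g).1)
  · intro hR
    exact h.trans _ _ _ (h.indiff_bet_val f).1 (h.trans _ _ _ hR (h.indiff_bet_val g).2)

theorem val_congr {f g : Act S X} (hfg : Indiff R f g) : h.val f = h.val g :=
  le_antisymm (h.rel_iff_val_le.1 hfg.2) (h.rel_iff_val_le.1 hfg.1)

theorem val_bet (t : unitInterval) : h.val (bet S p q t) = t :=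
  le_antisymm (h.bet_iff.1 (h.indiff_bet_val _).1) (h.bet_iff.1 (h.indiff_bet_val _).2)

theorem val_eq {f : Act S X} {t : unitInterval} (hf : Indiff R f (bet S p q t)) : h.val f = t := by
  rw [h.val_congr hf, h.val_bet]

theorem val_worst : h.val (constAct S q) = 0 := by rw [← bet_zero p q, h.val_bet]

theorem val_best : h.val (constAct S p) = 1 := by rw [← bet_one p q, h.val_bet]

/-- Independence lets each act be replaced by its equivalent bet inside the mixture, and a mixture
of bets is a bet. -/
theorem val_mixAct (a : unitInterval) (f g : Act S X) :
    (h.val (mixAct a f g) : ℝ) = a * h.val f + (1 - a) * h.val g := by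
  have hr := (convex_Icc (0 : ℝ) 1) (h.val f).2 (h.val g).2 a.2.1 (sub_nonneg.2 a.2.2) (by ring)
  have hbet := mixAct_bet (S := S) (p := p) (q := q) (a := a) (s := h.val f) (t := h.val g)
    (r := ⟨_, hr⟩) rfl
  have : h.val (mixAct a f g) = ⟨_, hr⟩ := by
    refine h.val_eq ?_
    rw [← hbet]
    exact ⟨h.mixAct_congr (h.indiff_bet_val f).1 (h.indiff_bet_val g).1 a,
      h.mixAct_congr (h.indiff_bet_val f).2 (h.indiff_bet_val g).2 a⟩
  rw [this]
  rfl

theorem val_constAct {u : X → ℝ}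
    (hu : ∀ x, u x = h.val (constAct S (dirac x))) (r : Prob X) :
    (h.val (constAct S r) : ℝ) = eu u r := by
  rw [show u = fun x => (h.val (constAct S (dirac x)) : ℝ) from funext hu]
  exact eq_eu_of_affine (v := fun r => (h.val (constAct S r) : ℝ))
    (fun a r r' => h.val_mixAct a (constAct S r) (constAct S r')) r

variable [DecidableEq S]

/-- Acts cannot be added, but half-half mixtures can be compared: mixing the joint act with `q` is
the same act as mixing the two separate pieces. As `q` has value 0, affinity gives additivity. -/
theorem val_pasteAct_insert (f : Act S X) {s : S} {T : Finset S} (hs : s ∉ T) :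
    (h.val (pasteAct (insert s T) f (constAct S q)) : ℝ)
      = h.val (pasteAct {s} f (constAct S q)) + h.val (pasteAct T f (constAct S q)) := by
  let a : unitInterval := ⟨1 / 2, by norm_num, by norm_num⟩
  have ha : (a : ℝ) = 1 / 2 := rfl
  have key : mixAct a (pasteAct (insert s T) f (constAct S q)) (constAct S q)
      = mixAct a (pasteAct {s} f (constAct S q)) (pasteAct T f (constAct S q)) := by
    funext i
    refine prob_ext fun x => ?_
    simp only [mixAct, mix_apply, ha]
    by_cases his : i = s
    · subst his
      simp [pasteAct, hs]
    · by_cases hiT : i ∈ T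
      · simp [pasteAct, hiT, his]
        ring
      · simp [pasteAct, hiT, his]
  have := congrArg (fun f => (h.val f : ℝ)) key
  simp only [val_mixAct, val_worst, ha, Set.Icc.coe_zero] at this
  linarith

/-- By statewise monotonicity `f s` may be replaced by its equivalent bet; the result is a mixture
of the bet on `s` with `q`. -/
theorem val_pasteAct_singleton (f : Act S X) (s : S) :
    (h.val (pasteAct {s} f (constAct S q)) : ℝ)
      = h.val (pasteAct {s} (constAct S p) (constAct S q)) * h.val (constAct S (f s)) := by
  have hf := h.indiff_bet_val (constAct S (f s))
  generalize h.val (constAct S (f s)) = t at hf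
  have key : Indiff R (pasteAct {s} f (constAct S q))
      (mixAct t (pasteAct {s} (constAct S p) (constAct S q)) (constAct S q)) := by
    have hpt : ∀ i, (i = s → pasteAct {s} f (constAct S q) i = f s ∧
        mixAct t (pasteAct {s} (constAct S p) (constAct S q)) (constAct S q) i = mix t p q) ∧
        (i ≠ s → pasteAct {s} f (constAct S q) i =
          mixAct t (pasteAct {s} (constAct S p) (constAct S q)) (constAct S q) i) := by
      refine fun i => ⟨?_, fun hi => ?_⟩
      · rintro rfl
        simp [pasteAct, mixAct, constAct]
      · simp [pasteAct, mixAct, constAct, hi, mix_self]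
    constructor
    · refine h.monotone _ _ fun i => ?_
      by_cases hi : i = s
      · rw [((hpt i).1 hi).1, ((hpt i).1 hi).2]
        exact hf.1
      · rw [(hpt i).2 hi]
        exact h.refl _
    · refine h.monotone _ _ fun i => ?_
      by_cases hi : i = s
      · rw [((hpt i).1 hi).1, ((hpt i).1 hi).2]
        exact hf.2
      · rw [(hpt i).2 hi]
        exact h.refl _
  rw [h.val_congr key, h.val_mixAct, h.val_worst, Set.Icc.coe_zero]
  ring

theorem val_pasteAct (f : Act S X) (T : Finset S) :
    (h.val (pasteAct T f (constAct S q)) : ℝ)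
      = ∑ s ∈ T, (h.val (pasteAct {s} (constAct S p) (constAct S q)) : ℝ)
          * h.val (constAct S (f s)) := by
  induction T using Finset.induction_on with
  | empty =>
    rw [show pasteAct ∅ f (constAct S q) = constAct S q by funext i; simp [pasteAct], h.val_worst]
    simp
  | insert s T hs ih =>
    rw [h.val_pasteAct_insert f hs, Finset.sum_insert hs, ih, h.val_pasteAct_singleton]

theorem val_eq_sum [Fintype S] (f : Act S X) :
    (h.val f : ℝ) = ∑ s, (h.val (pasteAct {s} (constAct S p) (constAct S q)) : ℝ)
      * h.val (constAct S (f s)) := by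
  rw [← h.val_pasteAct f Finset.univ]
  congr
  funext i
  simp [pasteAct]

/-- The Anscombe-Aumann representation, for a given normalized utility. -/
theorem exists_belief [Fintype S] {u : X → ℝ}
    (hu : ∀ x, u x = h.val (constAct S (dirac x))) : ∃ π : Prob S, R = seuPref u π := by
  have hsum : ∑ s, (h.val (pasteAct {s} (constAct S p) (constAct S q)) : ℝ) = 1 := by
    have := h.val_eq_sum (constAct S p)
    have hp : ∀ s, h.val (constAct S (constAct S p s)) = 1 := fun _ => h.val_best
    simpa [h.val_best, hp] using this.symm
  let π : Prob S := ⟨fun s => h.val (pasteAct {s} (constAct S p) (constAct S q)),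
    fun s => (h.val _).2.1, hsum⟩
  have hseu : ∀ f, (h.val f : ℝ) = seu u π f := fun f => by
    rw [h.val_eq_sum f]
    simp only [h.val_constAct hu]
    rfl
  refine ⟨π, ?_⟩
  funext f g
  refine propext ?_
  rw [h.rel_iff_val_le, seuPref, ← hseu, ← hseu]
  rfl

end IsBoundedRational

end AnscombeAumann

/-! ### From the axioms to the representation. -/

section Axiomatization

theorem exists_forall_rel {X : Type*} [Finite X] [Nonempty X] {r : X → X → Prop}
    (total : ∀ x y, r x y ∨ r y x) (trans : ∀ x y z, r x y → r y z → r x z) :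
    ∃ x, ∀ y, r x y := by
  have : IsTrans X fun x y => r y x := ⟨fun x y z hxy hyz => trans _ _ _ hyz hxy⟩
  refine Directed.finite_le (r := fun x y => r y x) (f := fun x : X => x) (fun x y => ?_) id
  rcases total x y with hxy | hxy
  · exact ⟨x, (total x x).elim id id, hxy⟩
  · exact ⟨y, hxy, (total y y).elim id id⟩

variable {S X : Type*} [Fintype S] [Nonempty S] [DecidableEq S] [Fintype X]
  {pref : PrefFamily S X}

omit [DecidableEq S] in
theorem StandardPostulates.isRational (h : StandardPostulates pref) (I : InfoSet S) :
    IsRational (pref I) :=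
  ⟨h.complete I, h.transitive I, h.archimedean I, h.monotone I, h.independence I⟩

omit [DecidableEq S] in
/-- The best and the worst outcome do not depend on the information set. -/
theorem StandardPostulates.exists_isBoundedRational [Nonempty X] (h : StandardPostulates pref) :
    ∃ x y : X, ∀ I, IsBoundedRational (pref I) (dirac x) (dirac y) := by
  have hF := h.isRational (InfoSet.full S)
  obtain ⟨x, hx⟩ := exists_forall_rel (X := X)
    (r := fun x y => pref (InfoSet.full S) (constAct S (dirac x)) (constAct S (dirac y)))
    (fun _ _ => hF.complete _ _) (fun _ _ _ => hF.trans _ _ _)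
  obtain ⟨y, hy⟩ := exists_forall_rel (X := X)
    (r := fun y x => pref (InfoSet.full S) (constAct S (dirac x)) (constAct S (dirac y)))
    (fun _ _ => hF.complete _ _) (fun _ _ _ hxy hyz => hF.trans _ _ _ hyz hxy)
  have hbest : ∀ r, pref (InfoSet.full S) (constAct S (dirac x)) (constAct S r) := by
    refine prob_induction hx fun a r r' hr hr' => ?_
    rw [← mixAct_self a (constAct S (dirac x))]
    exact hF.mixAct_congr hr hr' a
  have hworst : ∀ r, pref (InfoSet.full S) (constAct S r) (constAct S (dirac y)) := by
    refine prob_induction hy fun a r r' hr hr' => ?_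
    rw [← mixAct_self a (constAct S (dirac y))]
    exact hF.mixAct_congr hr hr' a
  refine ⟨x, y, fun I => ⟨h.isRational I, fun r => (h.invariant_risk I _ _).2 (hbest r),
    fun r => (h.invariant_risk I _ _).2 (hworst r), fun hyx => ?_⟩⟩
  obtain ⟨f, g, -, hfg⟩ := h.nontrivial I
  refine hfg (h.transitive I _ (constAct S (dirac y)) _ ?_ (h.transitive I _ _ _ hyx ?_))
  · exact h.monotone I _ _ fun s => (h.invariant_risk I _ _).2 (hworst _)
  · exact h.monotone I _ _ fun s => (h.invariant_risk I _ _).2 (hbest _)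

/-- Every preference of the family has an expected utility representation, with a common
utility. -/
theorem StandardPostulates.exists_seuPref [Nonempty X] (h : StandardPostulates pref) :
    ∃ (u : X → ℝ) (c : InfoSet S → Prob S),
      (∃ x y, u y < u x) ∧ ∀ I, pref I = seuPref u (c I) := by
  obtain ⟨x, y, hR⟩ := h.exists_isBoundedRational
  let u : X → ℝ := fun z => (hR (InfoSet.full S)).val (constAct S (dirac z))
  -- Preferences over constant acts do not depend on `I`, so the equivalent bets of outcomes, hence
  -- the normalised utilities, agree.
  have hu : ∀ I z, u z = (hR I).val (constAct S (dirac z)) := fun I z => by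
    have hb := (hR (InfoSet.full S)).indiff_bet_val (constAct S (dirac z))
    rw [(hR I).val_eq (t := (hR (InfoSet.full S)).val (constAct S (dirac z)))
      ⟨(h.invariant_risk I _ _).2 hb.1, (h.invariant_risk I _ _).2 hb.2⟩]
  choose c hc using fun I => (hR I).exists_belief (hu I)
  refine ⟨u, c, ⟨x, y, ?_⟩, hc⟩
  simp only [u, IsBoundedRational.val_best, IsBoundedRational.val_worst]
  exact zero_lt_one

theorem SatisfiesAxioms.exists_representation [Nonempty X] (h : SatisfiesAxioms pref) :
    ∃ (u : X → ℝ) (μ : Prob S) (d : Prob S → ℝ) (r : Prob S → Prob S → Prop),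
      IsInertialUpdating pref u μ d r ∧ LocallyNonsatiated μ d := by
  obtain ⟨u, c, ⟨x, y, hxy⟩, hc⟩ := h.standard.exists_seuPref
  have hinj : ∀ I J, pref I = pref J → c I = c J := fun I J hIJ =>
    seuPref_injective hxy.ne' (by rw [← hc, ← hc, hIJ] :
      (seuPref u (c I) : Act S X → Act S X → Prop) = seuPref u (c J))
  have hpref : ∀ I J, c I = c J → pref I = pref J := fun I J hIJ => by rw [hc, hc, hIJ]
  have hsingle : ∀ π, c (InfoSet.single π) = π := fun π => by
    refine belief_eq_of_compliance (u := u) hxy.ne' fun p q E => ?_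
    rw [← hc]
    exact h.compliance p q E π
  -- `I` and `{c I}` induce the same preference, so Responsiveness makes them intersect.
  have hmem : ∀ I, c I ∈ I.carrier := fun I => by
    obtain ⟨π, hπI, hπ⟩ := h.responsiveness I (InfoSet.single (c I)) (hpref _ _ (hsingle _).symm)
    rwa [show π = c I from hπ] at hπI
  -- Betweenness applies to `{c I} ⊆ J ⊆ I`, whose extremes induce the same preference.
  have hcons : IsConsistent c := ⟨hmem, fun I J hJI hIJ => hinj _ _
    (h.betweenness I (InfoSet.single (c I)) J (Set.singleton_subset_iff.2 hIJ) hJI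
      (hpref _ _ (hsingle _).symm)).symm⟩
  obtain ⟨d, hd, hr, hns, hmin⟩ := hcons.exists_distance (c (InfoSet.full S))
    (fun I hI => hcons.iia _ I (Set.subset_univ _) hI)
    -- Extremeness with the singleton `{c I}` as the inner set.
    (fun I hI hne hint => h.extremeness I (InfoSet.single (c I)) hI (isConvex_singleton _)
      (Set.singleton_subset_iff.2 hint) (fun heq => hne (hinj _ _ heq)) (hpref _ _ (hsingle _)))
    (fun π π' hne hππ' => by
      obtain ⟨ε, hε, hε'⟩ := h.weakContinuity π π' hne
        (hpref _ _ (by rw [hππ', hsingle]))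
      exact ⟨ε, hε, fun z hz => by rw [hinj _ _ (hε' z hz), hsingle]⟩)
  refine ⟨u, _, d, _, ⟨⟨x, y, hxy.ne'⟩, fun s => ?_, hd, hr, fun I => ⟨c I, hmin I, fun f g => ?_⟩⟩,
    hns⟩
  -- Were `s` null, lowering the prize from `x` to `y` at `s` alone would leave the value unchanged,
  -- against strict monotonicity.
  · refine lt_of_le_of_ne ((c (InfoSet.full S)).2.1 s) fun h0 => ?_
    have hstrict := h.standard.strict_monotone (constAct S (dirac x))
      (pasteAct {s} (constAct S (dirac y)) (constAct S (dirac x))) (fun t => ?_) ⟨s, ?_⟩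
    · rw [hc, strict_seuPref, seu_constAct, seu_pasteAct, probOf_coe, Finset.sum_singleton] at hstrict
      have h0' : ((c (InfoSet.full S)) : S → ℝ) s = 0 := h0.symm
      rw [h0'] at hstrict
      simp at hstrict
    · rw [hc, seuPref, seu_constAct, seu_constAct]
      by_cases hts : t = s <;> simp [pasteAct, constAct, hts, eu_dirac, hxy.le]
    · rw [hc, strict_seuPref, seu_constAct, seu_constAct]
      simpa [pasteAct, constAct, eu_dirac] using hxy
  · rw [hc]
    rfl

/-! ### From the representation to the axioms. -/

omit [Nonempty S] [DecidableEq S] in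
theorem eu_le_iff (u : X → ℝ) (π : Prob S) (p q : Prob X) :
    seuPref u π (constAct S p) (constAct S q) ↔ eu u q ≤ eu u p := by
  rw [seuPref, seu_constAct, seu_constAct]

theorem archimedean_of_lt {x y z : ℝ} (hxy : y < x) (hyz : z < y) :
    ∃ a b : unitInterval, (0 < a ∧ a < 1) ∧ (0 < b ∧ b < 1) ∧
      y < a * x + (1 - a) * z ∧ b * x + (1 - b) * z < y := by
  have hxz : 0 < x - z := by linarith
  have h0 : 0 < (y - z) / (x - z) := div_pos (by linarith) hxz
  have h1 : (y - z) / (x - z) < 1 := (div_lt_one hxz).2 (by linarith)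
  have ht : (y - z) / (x - z) * (x - z) = y - z := div_mul_cancel₀ _ hxz.ne'
  -- At weight `t` the mixture equals `y`; the weights `(1 + t) / 2` and `t / 2` lie on either side
  -- of it.
  generalize (y - z) / (x - z) = t at h0 h1 ht
  refine ⟨⟨(1 + t) / 2, by linarith, by linarith⟩, ⟨t / 2, by linarith, by linarith⟩,
    ⟨?_, ?_⟩, ⟨?_, ?_⟩, ?_, ?_⟩
  · exact show (0 : ℝ) < (1 + t) / 2 by linarith
  · exact show (1 + t) / 2 < (1 : ℝ) by linarith
  · exact show (0 : ℝ) < t / 2 by linarith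
  · exact show t / 2 < (1 : ℝ) by linarith
  · exact show y < (1 + t) / 2 * x + (1 - (1 + t) / 2) * z by nlinarith
  · exact show t / 2 * x + (1 - t / 2) * z < y by nlinarith

omit [DecidableEq S] in
theorem standardPostulates_of_seuPref {u : X → ℝ} {c : InfoSet S → Prob S}
    (hu : ∃ x y, u x ≠ u y) (hfull : ∀ s, 0 < (c (InfoSet.full S) : S → ℝ) s) :
    StandardPostulates fun I => (seuPref u (c I) : Act S X → Act S X → Prop) where
  complete _ _ _ := le_total _ _
  transitive _ _ _ _ hfg hgh := le_trans hgh hfg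
  archimedean I f g h hfg hgh := by
    obtain ⟨a, b, ha, hb, h1, h2⟩ :=
      archimedean_of_lt (strict_seuPref.1 hfg) (strict_seuPref.1 hgh)
    refine ⟨a, b, ha, hb, strict_seuPref.2 ?_, strict_seuPref.2 ?_⟩
    · rwa [seu_mixAct]
    · rwa [seu_mixAct]
  monotone I f g hfg := Finset.sum_le_sum fun s _ =>
    mul_le_mul_of_nonneg_left ((eu_le_iff u _ _ _).1 (hfg s)) ((c I).2.1 s)
  strict_monotone f g hfg := by
    rintro ⟨s, hs⟩
    rw [strict_seuPref, seu_constAct, seu_constAct] at hs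
    exact strict_seuPref.2 (Finset.sum_lt_sum
      (fun t _ => mul_le_mul_of_nonneg_left ((eu_le_iff u _ _ _).1 (hfg t)) (hfull t).le)
      ⟨s, Finset.mem_univ s, mul_lt_mul_of_pos_left hs (hfull s)⟩)
  nontrivial I := by
    obtain ⟨x, y, hxy⟩ := hu
    rcases hxy.lt_or_gt with hlt | hlt
    · refine ⟨constAct S (dirac y), constAct S (dirac x), strict_seuPref.2 ?_⟩
      rwa [seu_constAct, seu_constAct, eu_dirac, eu_dirac]
    · refine ⟨constAct S (dirac x), constAct S (dirac y), strict_seuPref.2 ?_⟩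
      rwa [seu_constAct, seu_constAct, eu_dirac, eu_dirac]
  independence I f g h a ha := by
    have ha' : (0 : ℝ) < a := ha
    simp only [seuPref, seu_mixAct, add_le_add_iff_right, mul_le_mul_iff_right₀ ha']
  invariant_risk I p q := (eu_le_iff u _ _ _).trans (eu_le_iff u _ _ _).symm

theorem IsInertialUpdating.satisfiesAxioms {u : X → ℝ} {μ : Prob S} {d : Prob S → ℝ}
    {r : Prob S → Prob S → Prop} (h : IsInertialUpdating pref u μ d r)
    (hwc : WeaklyContinuous d) (hns : LocallyNonsatiated μ d) : SatisfiesAxioms pref := by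
  choose c hmin hrep using h.represents
  obtain rfl : pref = fun I => seuPref u (c I) :=
    funext fun I => funext fun f => funext fun g => propext (hrep I f g)
  obtain ⟨x, y, hxy⟩ := h.nonconstant
  have hr := h.tieBreaker.strictTotal
  have hinj : ∀ I J, (seuPref u (c I) : Act S X → Act S X → Prop) = seuPref u (c J) →
      c I = c J := fun I J => seuPref_injective hxy
  have hmemMin : ∀ I, c I ∈ minOf (argMin d I.carrier) r := fun I => by
    rw [hmin]
    rfl
  have hmem : ∀ I, c I ∈ I.carrier := fun I => (hmemMin I).1.1
  have hle : ∀ I, ∀ π ∈ I.carrier, d (c I) ≤ d π := fun I => (hmemMin I).1.2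
  -- The posterior is least in all of `I`, not only in the argmin, since outside the argmin the
  -- tie-breaker follows `d`.
  have hclosest : ∀ I, ∀ π ∈ I.carrier, π ≠ c I → r π (c I) := fun I π hπ hne => by
    rcases (hle I π hπ).eq_or_lt with heq | hlt
    · exact (hmemMin I).2 π ⟨hπ, fun z hz => heq ▸ hle I z hz⟩ hne
    · exact h.tieBreaker.of_lt _ _ hlt
  have heq : ∀ I, ∀ π ∈ I.carrier, (∀ z ∈ I.carrier, d π ≤ d z) →
      (∀ z ∈ I.carrier, z ≠ π → r z π) → c I = π := fun I π hπ hd hz => by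
    have : π ∈ minOf (argMin d I.carrier) r := ⟨⟨hπ, hd⟩, fun z hz' => hz z hz'.1⟩
    rw [hmin] at this
    exact this.symm
  have hiia : ∀ I J : InfoSet S, J.carrier ⊆ I.carrier → c I ∈ J.carrier → c J = c I :=
    fun I J hJI hJ => heq J _ hJ (fun z hz => hle I z (hJI hz))
      fun z hz => hclosest I z (hJI hz)
  have hfull : c (InfoSet.full S) = μ := by
    by_contra hne
    exact (h.distance.lt_of_ne _ hne).not_ge (hle _ _ (Set.mem_univ μ))
  have hsingle : ∀ π, c (InfoSet.single π) = π := fun π => hmem (InfoSet.single π)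
  refine ⟨standardPostulates_of_seuPref h.nonconstant (by rw [hfull]; exact h.fullSupport),
    ?_, ?_, ?_, ?_, ?_⟩
  · intro p q E π
    simp only [hsingle]
    exact compliance_seuPref u π p q E
  · exact fun I J hIJ => ⟨c I, hmem I, hinj I J hIJ ▸ hmem J⟩
  · intro I J K hJK hKI hIJ
    have hc := hinj I J hIJ
    change seuPref u (c I) = seuPref u (c K)
    rw [hiia I K hKI (hJK (hc ▸ hmem J))]
  -- If both sets gave the same posterior, it would be a `d`-minimiser interior to `I` and distinct
  -- from `μ`, against local nonsatiation.
  · intro I J _ _ hJI hne hJ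
    have hc := hinj J I hJ
    have hneμ : c I ≠ μ := fun hμ => hne (by simp only [hμ, hfull])
    obtain ⟨ε, hε, hsub⟩ := exists_eucl_lt_subset
      (mem_interior_iff_mem_nhds.1 (hJI (hc ▸ hmem J : c I ∈ J.carrier)))
    obtain ⟨π, hπ, hlt⟩ := hns _ hneμ ε hε
    exact hlt.not_ge (hle I π (hsub π hπ))
  · intro π π' hne hseg
    have hc : c (InfoSet.segm π π') = π := by rw [hinj _ _ hseg, hsingle]
    have hd : ∀ z ∈ seg π π', d π ≤ d z := fun z hz => by
      have := hle (InfoSet.segm π π') z hz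
      rwa [hc] at this
    -- A tie would produce a point of the segment strictly nearer than the choice `π`.
    have hlt : d π < d π' := by
      refine lt_of_le_of_ne (hd π' (right_mem_seg π π')) fun hd' => ?_
      obtain ⟨a, _, _, ha⟩ := h.distance.mix_lt π π' hne hd'
      exact ha.not_ge (hd _ (mem_seg_mix a π π'))
    obtain ⟨ε, hε, hball⟩ := hwc π π' hlt
    refine ⟨ε, hε, fun z hz => ?_⟩
    have hpair : c (InfoSet.pair π z) = π := by
      refine heq _ π (Set.mem_insert _ _) ?_ ?_
      · rintro w (rfl | rfl)
        · exact le_rfl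
        · exact (hball _ hz).le
      · rintro w (rfl | rfl) hw
        · exact absurd rfl hw
        · exact h.tieBreaker.of_lt _ _ (hball _ hz)
    simp only [hpair, hsingle]

end Axiomatization

end InertialUpdating

theorem theorem1 {S X : Type*} [Fintype S] [Nonempty S] [DecidableEq S] [Fintype X] [Nonempty X]
    (pref : PrefFamily S X) :
    (SatisfiesAxioms pref →
      ∃ (u : X → ℝ) (μ : Prob S) (d : Prob S → ℝ) (r : Prob S → Prob S → Prop),
        IsInertialUpdating pref u μ d r ∧ LocallyNonsatiated μ d) ∧
    (∀ (u : X → ℝ) (μ : Prob S) (d : Prob S → ℝ) (r : Prob S → Prob S → Prop),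
      IsInertialUpdating pref u μ d r → WeaklyContinuous d → LocallyNonsatiated μ d →
        SatisfiesAxioms pref) := by
  exact ⟨fun h => h.exists_representation, fun _ _ _ _ h hwc hns => h.satisfiesAxioms hwc hns⟩
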